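/- For $B\in\mathbb C^{n\times n}$ and a function $g$ analytic in a neighbourhood of the spectrum $\sigma(B)$, let $$g(B)=\frac1{2\pi i}\int_\Gamma g(\lambda)(\lambda\mathbf 1-B)^{-1}\,d\lambda,$$ where the contour $\Gamma$ lies in the domain of $g$ and encloses $\sigma(B)$ (for instance, $\Gamma$ consists of positively oriented circles of a sufficiently small radius about the eigenvalues of $B$). Let $A\in\mathbb C^{n\times n}$, let $N\ge1$, and let $z_1,\dots,z_N\in\mathbb C$ be points that are not necessarily distinct; the multiplicity $n_k$ of $z_k$ is the number of indices $i$ with $z_i=z_k$. Let $f$ be an analytic function defined on an open set containing the convex hull of $\sigma(A)\cup\{z_1,\dots,z_N\}$. Let $u$ and $v$ be complex polynomials such that $\deg u\le N-1$, $v(z_k)\ne0$ for $k=1,\dots,N$, and $v(\lambda)\ne0$ for all $\lambda\in\sigma(A)$, and suppose that the rational function $r=u/v$ satisfies the interpolation conditions $$r^{(j)}(z_k)=f^{(j)}(z_k),\qquad k=1,\dots,N,\quad j=0,1,\dots,n_k-1.$$ Put $\Omega(z)=\prod_{k=1}^N(z-z_k)$. Then for every linear functional $\xi$ on $\mathbb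 C^{n\times n}$ the maximum below exists, and $$\bigl|\xi\bigl[f(A)-r(A)\bigr]\bigr|\le\max_{\substack{t\in[0,1]\\ \mu\in\operatorname{co}\{z_1,\dots,z_N\}}}\left|\xi\left[\Omega(A)[v(A)]^{-1}\frac{(vf)^{(N)}\bigl((1-t)\mu\mathbf 1+tA\bigr)}{N!}\right]\right|,$$ where $\operatorname{co}$ denotes the convex hull. -/

import Mathlib

open Filter Topology

noncomputable section

/-- The contour integral `(2πi)⁻¹ ∫_Γ f(λ) (λ1 - A)⁻¹ dλ` (computed entrywise), where the contour `Γ`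
consists of the positively oriented circles of radius `ε` centred at the eigenvalues of `A`. -/
def contourCalculus {n : ℕ} (f : ℂ → ℂ) (A : Matrix (Fin n) (Fin n) ℂ) (ε : ℝ) :
    Matrix (Fin n) (Fin n) ℂ :=
  ∑ c ∈ (Matrix.finite_spectrum A).toFinset,
    Matrix.of fun i j =>
      (2 * Real.pi * Complex.I : ℂ)⁻¹ *
        ∮ z in C(c, ε), f z * ((z • (1 : Matrix (Fin n) (Fin n) ℂ) - A)⁻¹) i j

/-- The function `f` applied to the matrix `A`:
`f(A) = (2πi)⁻¹ ∫_Γ f(λ) (λ1 - A)⁻¹ dλ`, where `Γ` encloses the spectrum of `A`.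
As `Γ` we take the union of circles of radius `ε` about the eigenvalues; if `f` is analytic near
the spectrum, then the integral does not depend on `ε` for all small `ε > 0`,
so the limit below is this common value. -/
def matrixFunction {n : ℕ} (f : ℂ → ℂ) (A : Matrix (Fin n) (Fin n) ℂ) :
    Matrix (Fin n) (Fin n) ℂ :=
  limUnder (𝓝[>] (0 : ℝ)) (contourCalculus f A)

/-- The definition is proper: for `f` analytic near the spectrum, `matrixFunction f A` is the contour
integral over the circles of radius `ε`, for all small `ε > 0`. -/
theorem matrixFunction_eq_contourCalculus {n : ℕ} (f : ℂ → ℂ) (A : Matrix (Fin n) (Fin n) ℂ)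
    (hf : AnalyticOnNhd ℂ f (spectrum ℂ A)) :
    ∀ᶠ ε in 𝓝[>] (0 : ℝ), contourCalculus f A ε = matrixFunction f A := by
  have hfin := Matrix.finite_spectrum A
  have hev : ∀ c ∈ spectrum ℂ A, ∀ᶠ w in 𝓝 c,
      DifferentiableAt ℂ f w ∧ (w ∈ spectrum ℂ A → w = c) := by
    intro c hc
    have h1 : ∀ᶠ w in 𝓝 c, DifferentiableAt ℂ f w :=
      (hf c hc).eventually_analyticAt.mono fun w hw => hw.differentiableAt
    have h2 : ∀ᶠ w in 𝓝 c, w ∈ (spectrum ℂ A \ {c})ᶜ :=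
      (hfin.subset Set.sdiff_subset).isClosed.isOpen_compl.mem_nhds (by simp)
    filter_upwards [h1, h2] with w hw1 hw2
    exact ⟨hw1, fun hw => by_contra fun hne => hw2 ⟨hw, hne⟩⟩
  have hrad : ∀ᶠ δ in 𝓝[>] (0 : ℝ), ∀ c ∈ spectrum ℂ A, ∀ w ∈ Metric.closedBall c δ,
      DifferentiableAt ℂ f w ∧ (w ∈ spectrum ℂ A → w = c) := by
    rw [hfin.eventually_all]
    intro c hc
    obtain ⟨δ, hδ, h⟩ := Metric.eventually_nhds_iff_ball.1 (hev c hc)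
    filter_upwards [Ioo_mem_nhdsGT hδ] with ε hε w hw
    exact h w (Metric.closedBall_subset_ball hε.2 hw)
  obtain ⟨δ, hδ, hδ0⟩ := (hrad.and self_mem_nhdsWithin).exists
  have hδ0 : 0 < δ := hδ0
  have hdiff : ∀ i j, ∀ w, w ∉ spectrum ℂ A → DifferentiableAt ℂ
      (fun z : ℂ => ((z • (1 : Matrix (Fin n) (Fin n) ℂ) - A)⁻¹) i j) w := by
    intro i j w hw
    have hu : IsUnit (w • (1 : Matrix (Fin n) (Fin n) ℂ) - A).det := by
      rw [← Matrix.isUnit_iff_isUnit_det]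
      have := spectrum.notMem_iff.1 hw
      rwa [Algebra.algebraMap_eq_smul_one] at this
    have hE : ∀ a b, Differentiable ℂ
        (fun z : ℂ => (z • (1 : Matrix (Fin n) (Fin n) ℂ) - A) a b) := by
      intro a b
      simp only [Matrix.sub_apply, Matrix.smul_apply]
      fun_prop
    have hdet : ∀ M : ℂ → Matrix (Fin n) (Fin n) ℂ,
        (∀ a b, Differentiable ℂ fun z => M z a b) → Differentiable ℂ fun z => (M z).det := by
      intro M hM
      simp only [Matrix.det_apply]
      fun_prop
    have hadj : Differentiable ℂ
        (fun z : ℂ => (z • (1 : Matrix (Fin n) (Fin n) ℂ) - A).adjugate i j) := by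
      simp only [Matrix.adjugate_apply]
      apply hdet
      intro a b
      by_cases h : a = j
      · subst h
        simp
      · simp only [Matrix.updateRow_ne h]
        exact hE a b
    simp only [Matrix.inv_def, Ring.inverse_eq_inv', Matrix.smul_apply, smul_eq_mul]
    exact ((hdet _ hE w).inv hu.ne_zero).mul (hadj w)
  have hconst : ∀ ε ∈ Set.Ioc 0 δ, contourCalculus f A ε = contourCalculus f A δ := by
    intro ε hε
    unfold contourCalculus
    refine Finset.sum_congr rfl fun c hc => ?_
    have hc : c ∈ spectrum ℂ A := by simpa using hc
    ext i j
    simp only [Matrix.of_apply]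
    congr 1
    have hd : ∀ w ∈ Metric.closedBall c δ \ Metric.ball c ε, DifferentiableAt ℂ
        (fun z : ℂ => f z * ((z • (1 : Matrix (Fin n) (Fin n) ℂ) - A)⁻¹) i j) w := by
      intro w hw
      refine (hδ c hc w hw.1).1.mul (hdiff i j w fun hs => ?_)
      exact hw.2 ((hδ c hc w hw.1).2 hs ▸ Metric.mem_ball_self hε.1)
    refine (Complex.circleIntegral_eq_of_differentiable_on_annulus_off_countable hε.1 hε.2
      Set.countable_empty (fun w hw => (hd w hw).continuousAt.continuousWithinAt) ?_).symm
    intro w hw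
    exact hd w ⟨Metric.ball_subset_closedBall hw.1.1,
      fun h => hw.1.2 (Metric.ball_subset_closedBall h)⟩
  have hevc : ∀ᶠ ε in 𝓝[>] (0 : ℝ), contourCalculus f A ε = contourCalculus f A δ := by
    filter_upwards [Ioc_mem_nhdsGT hδ0] with ε hε using hconst ε hε
  have hlim : matrixFunction f A = contourCalculus f A δ :=
    (tendsto_const_nhds.congr' (hevc.mono fun _ h => h.symm)).limUnder_eq
  rw [hlim]
  exact hevc

/-- The multiplicity of the `k`-th node: how many times `z k` is repeated in the list `z`. -/
def nodeMultiplicity {N : ℕ} (z : Fin N → ℂ) (k : Fin N) : ℕ :=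
  Nat.card {i : Fin N // z i = z k}

/-- `r` satisfies the interpolation conditions `r^{(j)}(z_k) = f^{(j)}(z_k)` for all nodes `z_k` and
all `j` less than the multiplicity of `z_k`. -/
def Interpolates {N : ℕ} (r f : ℂ → ℂ) (z : Fin N → ℂ) : Prop :=
  ∀ k : Fin N, ∀ j < nodeMultiplicity z k, iteratedDeriv j r (z k) = iteratedDeriv j f (z k)

/-- `Ω(X) = ∏ (X - z_k)`. -/
def nodePolynomial {N : ℕ} (z : Fin N → ℂ) : Polynomial ℂ :=
  ∏ k, (Polynomial.X - Polynomial.C (z k))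

/-- `Ω(A) v(A)⁻¹ (v f)^{(N)}((1 - t) μ 1 + t A) / N!`. -/
def remainderMatrix {n N : ℕ} (A : Matrix (Fin n) (Fin n) ℂ) (z : Fin N → ℂ) (f : ℂ → ℂ)
    (v : Polynomial ℂ) (t : ℝ) (μ : ℂ) : Matrix (Fin n) (Fin n) ℂ :=
  Polynomial.aeval A (nodePolynomial z) * (Polynomial.aeval A v)⁻¹ *
    ((N.factorial : ℂ)⁻¹ •
      matrixFunction (iteratedDeriv N fun w => v.eval w * f w)
        (((1 - (t : ℂ)) * μ) • (1 : Matrix (Fin n) (Fin n) ℂ) + (t : ℂ) • A))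

end

/-!
Let `h w = (w - a) * g w`. At `(1 - s) a 1 + s A`, the derivative of `s ^ (p + 1) g⁽ᵖ⁾` with respect
to `s` is `s ^ p h⁽ᵖ⁺¹⁾`, so integrating over `[0, 1]` bounds `g⁽ᵖ⁾(A)` by `1 / (p + 1)` times the
supremum of `h⁽ᵖ⁺¹⁾` along the segment from `a 1` to `A`. The interpolation conditions give
`v f - u = Ω φ` with `φ` analytic, hence `f(A) - r(A) = Ω(A) v(A)⁻¹ φ(A)`. Restoring the factors of
`Ω` one at a time bounds `φ(A)` by `1 / N!` times the supremum of `(Ω φ)⁽ᴺ⁾ = (v f)⁽ᴺ⁾`; the points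
`(1 - t) μ 1 + t A` suffice because homotheties of ratio in `[0, 1]` centred in a convex set are
closed under composition. Smoothness in `s` is read off Taylor's formula for `g(A)` on generalized
eigenspaces, where `A - c` is nilpotent.
-/

section AdmissibleRadius

/-- The circles of radius `ε` about the points of `s` are as small as the contour in
`contourCalculus` needs: `f` is holomorphic on each closed disc, and no disc contains a second point
of `s`. -/
structure IsAdmissibleRadius (f : ℂ → ℂ) (s : Set ℂ) (ε : ℝ) : Prop where
  pos : 0 < ε
  differentiableOn : ∀ c ∈ s, DifferentiableOn ℂ f (Metric.closedBall c ε)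
  eq_of_mem_closedBall : ∀ c ∈ s, ∀ w ∈ s, w ∈ Metric.closedBall c ε → w = c

theorem eventually_isAdmissibleRadius {f : ℂ → ℂ} {s : Set ℂ} (hs : s.Finite)
    (hf : AnalyticOnNhd ℂ f s) : ∀ᶠ ε in 𝓝[>] (0 : ℝ), IsAdmissibleRadius f s ε := by
  have hball : ∀ᶠ ε in 𝓝[>] (0 : ℝ), ∀ c ∈ s, ∀ w ∈ Metric.closedBall c ε,
      DifferentiableAt ℂ f w ∧ (w ∈ s → w = c) := by
    rw [hs.eventually_all]
    intro c hc
    have hdiff : ∀ᶠ w in 𝓝 c, DifferentiableAt ℂ f w :=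
      (hf c hc).eventually_analyticAt.mono fun w hw => hw.differentiableAt
    have hisol : ∀ᶠ w in 𝓝 c, w ∈ (s \ {c})ᶜ :=
      (hs.subset Set.sdiff_subset).isClosed.isOpen_compl.mem_nhds (by simp)
    obtain ⟨δ, hδ, h⟩ := Metric.eventually_nhds_iff_ball.1 (hdiff.and hisol)
    filter_upwards [Ioo_mem_nhdsGT hδ] with ε hε w hw
    obtain ⟨hwd, hws⟩ := h w (Metric.closedBall_subset_ball hε.2 hw)
    exact ⟨hwd, fun hw => by_contra fun hne => hws ⟨hw, hne⟩⟩
  filter_upwards [hball, self_mem_nhdsWithin] with ε h hε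
  exact ⟨hε, fun c hc w hw => (h c hc w hw).1.differentiableWithinAt,
    fun c hc w hw hwc => (h c hc w hwc).2 hw⟩

namespace IsAdmissibleRadius

variable {f : ℂ → ℂ} {s : Set ℂ} {ε : ℝ} {c w : ℂ}

theorem notMem_of_mem_sphere (h : IsAdmissibleRadius f s ε) (hc : c ∈ s)
    (hw : w ∈ Metric.sphere c ε) : w ∉ s := fun hws => by
  rw [h.eq_of_mem_closedBall c hc w hws (Metric.sphere_subset_closedBall hw)] at hw
  simp [h.pos.ne] at hw

theorem continuousOn_sphere (h : IsAdmissibleRadius f s ε) (hc : c ∈ s) :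
    ContinuousOn f (Metric.sphere c ε) :=
  (h.differentiableOn c hc).continuousOn.mono Metric.sphere_subset_closedBall

end IsAdmissibleRadius

theorem circleIntegral_eq_zero_of_differentiableOn {f : ℂ → ℂ} {c : ℂ} {ε : ℝ} (hε : 0 ≤ ε)
    (hf : DifferentiableOn ℂ f (Metric.closedBall c ε)) : ∮ w in C(c, ε), f w = 0 :=
  (hf.mono Metric.closure_ball_subset_closedBall).diffContOnCl.circleIntegral_eq_zero hε

theorem IsAdmissibleRadius.circleIntegral_mul_inv_pow {f : ℂ → ℂ} {s : Set ℂ} {ε : ℝ} {a c : ℂ}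
    (h : IsAdmissibleRadius f s ε) (ha : a ∈ s) (hc : c ∈ s) (j : ℕ) :
    (∮ w in C(a, ε), f w * ((w - c) ^ (j + 1))⁻¹) =
      if c = a then 2 * Real.pi * Complex.I * ((j.factorial : ℂ)⁻¹ * iteratedDeriv j f c)
      else 0 := by
  have hf := h.differentiableOn a ha
  split_ifs with hca
  · subst hca
    calc (∮ w in C(c, ε), f w * ((w - c) ^ (j + 1))⁻¹)
        = ∮ w in C(c, ε), (1 / (w - c) ^ (j + 1)) • f w := by
          simp only [one_div, smul_eq_mul, mul_comm]
      _ = _ := by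
          rw [hf.circleIntegral_one_div_sub_center_pow_smul h.pos j, smul_eq_mul]
          ring
  · refine circleIntegral_eq_zero_of_differentiableOn h.pos.le
      (hf.mul (DifferentiableOn.inv (by fun_prop) fun w hw => pow_ne_zero _ ?_))
    exact sub_ne_zero.2 fun hwc => hca (h.eq_of_mem_closedBall a ha c hc (hwc ▸ hw))

end AdmissibleRadius

section Resolvent

theorem isUnit_smul_one_sub {𝕜 R : Type*} [CommSemiring 𝕜] [Ring R] [Algebra 𝕜 R] {b : R} {w : 𝕜}
    (hw : w ∉ spectrum 𝕜 b) : IsUnit (w • 1 - b) := by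
  simpa only [Algebra.algebraMap_eq_smul_one] using spectrum.notMem_iff.1 hw

variable {κ 𝕜 : Type*} [Fintype κ] [DecidableEq κ]

theorem smul_resolvent_eq_one_add_mul [CommRing 𝕜] {A : Matrix κ κ 𝕜} {w : 𝕜}
    (hw : w ∉ spectrum 𝕜 A) : w • (w • 1 - A)⁻¹ = 1 + A * (w • 1 - A)⁻¹ := by
  have hdet := (Matrix.isUnit_iff_isUnit_det _).1 (isUnit_smul_one_sub hw)
  rw [← sub_eq_iff_eq_add, ← smul_one_mul, ← sub_mul, Matrix.mul_nonsing_inv _ hdet]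

theorem continuousOn_resolvent_apply [Field 𝕜] [TopologicalSpace 𝕜] [IsTopologicalDivisionRing 𝕜]
    (A : Matrix κ κ 𝕜) (i j : κ) :
    ContinuousOn (fun w : 𝕜 => (w • 1 - A)⁻¹ i j) (spectrum 𝕜 A)ᶜ := by
  simp only [Matrix.inv_def, Ring.inverse_eq_inv', Matrix.smul_apply, smul_eq_mul]
  have hcont : Continuous fun w : 𝕜 => w • 1 - A := by fun_prop
  refine (hcont.matrix_det.continuousOn.inv₀ fun w hw => ?_).mul
    (hcont.matrix_adjugate.matrix_elem i j).continuousOn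
  exact ((Matrix.isUnit_iff_isUnit_det _).1 (isUnit_smul_one_sub hw)).ne_zero

end Resolvent

section FunctionalCalculus

variable {n : ℕ} {A : Matrix (Fin n) (Fin n) ℂ} {f g : ℂ → ℂ} {ε : ℝ}

theorem IsAdmissibleRadius.circleIntegrable_mul_resolvent
    (hf : IsAdmissibleRadius f (spectrum ℂ A) ε) {c : ℂ} (hc : c ∈ spectrum ℂ A) (i j : Fin n) :
    CircleIntegrable (fun w => f w * (w • 1 - A)⁻¹ i j) c ε :=
  ((hf.continuousOn_sphere hc).mul ((continuousOn_resolvent_apply A i j).mono fun _ hw =>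
    hf.notMem_of_mem_sphere hc hw)).circleIntegrable hf.pos.le

theorem contourCalculus_const_mul (a : ℂ) :
    contourCalculus (fun w => a * f w) A ε = a • contourCalculus f A ε := by
  ext i j
  simp only [contourCalculus, Matrix.smul_apply, Matrix.sum_apply, Matrix.of_apply, smul_eq_mul,
    Finset.mul_sum, mul_assoc a, circleIntegral.integral_const_mul]
  exact Finset.sum_congr rfl fun c _ => mul_left_comm _ _ _

theorem contourCalculus_add (hf : IsAdmissibleRadius f (spectrum ℂ A) ε)
    (hg : IsAdmissibleRadius g (spectrum ℂ A) ε) :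
    contourCalculus (fun w => f w + g w) A ε = contourCalculus f A ε + contourCalculus g A ε := by
  rw [contourCalculus, contourCalculus, contourCalculus, ← Finset.sum_add_distrib]
  refine Finset.sum_congr rfl fun c hc => ?_
  have hc : c ∈ spectrum ℂ A := by simpa using hc
  ext i j
  simp only [Matrix.add_apply, Matrix.of_apply, add_mul, ← mul_add]
  rw [circleIntegral.integral_add (hf.circleIntegrable_mul_resolvent hc i j)
    (hg.circleIntegrable_mul_resolvent hc i j)]

theorem contourCalculus_id_mul (hf : IsAdmissibleRadius f (spectrum ℂ A) ε) :
    contourCalculus (fun w => w * f w) A ε = A * contourCalculus f A ε := by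
  rw [contourCalculus, contourCalculus, Finset.mul_sum]
  refine Finset.sum_congr rfl fun c hc => ?_
  have hc : c ∈ spectrum ℂ A := by simpa using hc
  have hint := hf.circleIntegrable_mul_resolvent hc
  ext i j
  have hresolvent : Set.EqOn (fun w => w * f w * (w • 1 - A)⁻¹ i j)
      (fun w => f w * (1 : Matrix (Fin n) (Fin n) ℂ) i j +
        ∑ k, A i k * (f w * (w • 1 - A)⁻¹ k j)) (Metric.sphere c ε) := by
    intro w hw
    have hw := congrFun₂ (smul_resolvent_eq_one_add_mul (hf.notMem_of_mem_sphere hc hw)) i j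
    simp only [Matrix.smul_apply, Matrix.add_apply, Matrix.mul_apply, smul_eq_mul] at hw
    simp only [mul_left_comm (A i _) (f w), ← Finset.mul_sum, ← mul_add, ← hw]
    ring
  have hcauchy : ∮ w in C(c, ε), f w * (1 : Matrix (Fin n) (Fin n) ℂ) i j = 0 :=
    circleIntegral_eq_zero_of_differentiableOn hf.pos.le ((hf.differentiableOn c hc).mul_const _)
  have hconst : CircleIntegrable (fun w => f w * (1 : Matrix (Fin n) (Fin n) ℂ) i j) c ε :=
    ((hf.continuousOn_sphere hc).mul continuousOn_const).circleIntegrable hf.pos.le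
  have hint' : ∀ k, CircleIntegrable (fun w => A i k * (f w * (w • 1 - A)⁻¹ k j)) c ε :=
    fun k => (hint k j).const_smul (a := A i k)
  simp only [Matrix.mul_apply, Matrix.of_apply]
  rw [circleIntegral.integral_congr hf.pos.le hresolvent, circleIntegral.integral_add
    hconst (CircleIntegrable.fun_sum _ fun k _ => hint' k), hcauchy, zero_add,
    circleIntegral.integral_fun_sum fun k _ => hint' k, Finset.mul_sum]
  simp only [circleIntegral.integral_const_mul]
  exact Finset.sum_congr rfl fun k _ => mul_left_comm _ _ _

theorem matrixFunction_congr (hfg : ∀ c ∈ spectrum ℂ A, f =ᶠ[𝓝 c] g) :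
    matrixFunction f A = matrixFunction g A := by
  have hball : ∀ᶠ ε in 𝓝[>] (0 : ℝ), ∀ c ∈ spectrum ℂ A, Set.EqOn f g (Metric.sphere c ε) := by
    rw [(Matrix.finite_spectrum A).eventually_all]
    intro c hc
    obtain ⟨δ, hδ, h⟩ := Metric.eventually_nhds_iff_ball.1 (hfg c hc)
    filter_upwards [Ioo_mem_nhdsGT hδ] with ε hε w hw
    exact h w (Metric.closedBall_subset_ball hε.2 (Metric.sphere_subset_closedBall hw))
  refine congrArg lim (Filter.map_congr ?_)
  filter_upwards [hball, self_mem_nhdsWithin] with ε h hε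
  refine Finset.sum_congr rfl fun c hc => ?_
  ext i j
  simp only [Matrix.of_apply]
  congr 1
  refine circleIntegral.integral_congr (le_of_lt hε) fun w hw => ?_
  simp only [h c (by simpa using hc) hw]

theorem matrixFunction_const_mul (hf : AnalyticOnNhd ℂ f (spectrum ℂ A)) (a : ℂ) :
    matrixFunction (fun w => a * f w) A = a • matrixFunction f A := by
  obtain ⟨ε, hafε, hfε⟩ := ((matrixFunction_eq_contourCalculus _ A
    (analyticOnNhd_const.mul hf)).and (matrixFunction_eq_contourCalculus f A hf)).exists
  rw [← hafε, ← hfε, contourCalculus_const_mul]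

theorem matrixFunction_add (hf : AnalyticOnNhd ℂ f (spectrum ℂ A))
    (hg : AnalyticOnNhd ℂ g (spectrum ℂ A)) :
    matrixFunction (fun w => f w + g w) A = matrixFunction f A + matrixFunction g A := by
  have hfin := Matrix.finite_spectrum A
  obtain ⟨ε, ⟨hfgε, hfε, hgε⟩, hfr, hgr⟩ := (((matrixFunction_eq_contourCalculus _ A
    (hf.add hg)).and ((matrixFunction_eq_contourCalculus f A hf).and
    (matrixFunction_eq_contourCalculus g A hg))).and ((eventually_isAdmissibleRadius hfin hf).and
    (eventually_isAdmissibleRadius hfin hg))).exists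
  rw [← hfε, ← hgε, ← contourCalculus_add hfr hgr]
  exact hfgε.symm

theorem matrixFunction_id_mul (hf : AnalyticOnNhd ℂ f (spectrum ℂ A)) :
    matrixFunction (fun w => w * f w) A = A * matrixFunction f A := by
  obtain ⟨ε, ⟨hidε, hfε⟩, hfr⟩ := (((matrixFunction_eq_contourCalculus _ A
    (analyticOnNhd_id.mul hf)).and (matrixFunction_eq_contourCalculus f A hf)).and
    (eventually_isAdmissibleRadius (Matrix.finite_spectrum A) hf)).exists
  rw [← hfε, ← contourCalculus_id_mul hfr]
  exact hidε.symm

theorem analyticOnNhd_eval (p : Polynomial ℂ) (s : Set ℂ) :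
    AnalyticOnNhd ℂ (fun w => p.eval w) s :=
  (AnalyticOnNhd.eval_polynomial p).mono (Set.subset_univ s)

theorem matrixFunction_eval_mul (hf : AnalyticOnNhd ℂ f (spectrum ℂ A)) (p : Polynomial ℂ) :
    matrixFunction (fun w => p.eval w * f w) A = Polynomial.aeval A p * matrixFunction f A := by
  induction p using Polynomial.induction_on with
  | C a =>
    simp only [Polynomial.eval_C, Polynomial.aeval_C, Algebra.algebraMap_eq_smul_one,
      smul_one_mul, matrixFunction_const_mul hf]
  | add p q hp hq =>
    simp only [Polynomial.eval_add, add_mul, map_add, ← hp, ← hq]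
    exact matrixFunction_add ((analyticOnNhd_eval p _).mul hf) ((analyticOnNhd_eval q _).mul hf)
  | monomial k a ih =>
    have hfactor : Polynomial.C a * Polynomial.X ^ (k + 1) =
        Polynomial.X * (Polynomial.C a * Polynomial.X ^ k) := by ring
    simp only [hfactor, Polynomial.eval_mul (p := Polynomial.X), Polynomial.eval_X,
      mul_assoc (_ : ℂ) _ (f _)]
    rw [matrixFunction_id_mul ((analyticOnNhd_eval _ _).mul hf), ih, map_mul _ Polynomial.X,
      Polynomial.aeval_X, mul_assoc]

end FunctionalCalculus

section PrimaryResolution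

/-- A decomposition of the identity into elements `e i` annihilated by powers of `b - c i`, each
`c i` lying in the spectrum of `b`, as given by the projections onto generalized eigenspaces.
Neither orthogonality of the `e i` nor distinctness of the `c i` is required, so that the notion
survives the passage from `b` to a polynomial in `b`. -/
structure IsPrimaryResolution {𝕜 R ι : Type*} [Field 𝕜] [Ring R] [Algebra 𝕜 R] [Fintype ι]
    (b : R) (c : ι → 𝕜) (e : ι → R) (m : ℕ) : Prop where
  sum_eq_one : ∑ i, e i = 1
  pow_mul_eq_zero : ∀ i, (b - c i • 1) ^ m * e i = 0
  mem_spectrum : ∀ i, c i ∈ spectrum 𝕜 b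

theorem IsPrimaryResolution.smul_one_sub_mul_sum {𝕜 R ι : Type*} [Field 𝕜] [Ring R] [Algebra 𝕜 R]
    [Fintype ι] {b : R} {c : ι → 𝕜} {e : ι → R} {m : ℕ} (h : IsPrimaryResolution b c e m) {w : 𝕜}
    (hw : ∀ i, w ≠ c i) :
    (w • 1 - b) * ∑ i, ∑ j ∈ Finset.range m,
      ((w - c i) ^ (j + 1))⁻¹ • ((b - c i • 1) ^ j * e i) = 1 := by
  rw [Finset.mul_sum]
  refine (Finset.sum_congr rfl fun i _ => ?_).trans h.sum_eq_one
  have hsplit : w • 1 - b = (w - c i) • 1 - (b - c i • 1) := by module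
  have htelescope : ∀ j, (w • 1 - b) * (((w - c i) ^ (j + 1))⁻¹ • ((b - c i • 1) ^ j * e i)) =
      ((w - c i) ^ j)⁻¹ • ((b - c i • 1) ^ j * e i) -
        ((w - c i) ^ (j + 1))⁻¹ • ((b - c i • 1) ^ (j + 1) * e i) := by
    intro j
    have hcancel : (w - c i) * ((w - c i) ^ (j + 1))⁻¹ = ((w - c i) ^ j)⁻¹ := by
      rw [pow_succ', mul_inv, mul_inv_cancel_left₀ (sub_ne_zero.2 (hw i))]
    rw [hsplit, sub_mul, smul_mul_smul_comm, one_mul, mul_smul_comm, ← mul_assoc, ← pow_succ',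
      hcancel]
  rw [Finset.mul_sum, Finset.sum_congr rfl fun j _ => htelescope j, Finset.sum_range_sub',
    h.pow_mul_eq_zero]
  simp

theorem charpoly_dvd_prod_roots_pow_card {κ 𝕜 : Type*} [Fintype κ] [DecidableEq κ] [Field 𝕜]
    [IsAlgClosed 𝕜] [DecidableEq 𝕜] (A : Matrix κ κ 𝕜) :
    A.charpoly ∣ ∏ c ∈ A.charpoly.roots.toFinset,
      (Polynomial.X - Polynomial.C c) ^ Fintype.card κ := by
  nth_rw 1 [(IsAlgClosed.splits A.charpoly).eq_prod_roots_of_monic A.charpoly_monic]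
  rw [Finset.prod_multiset_map_count]
  refine Finset.prod_dvd_prod_of_dvd _ _ fun c _ => pow_dvd_pow _ ?_
  rw [← A.charpoly_natDegree_eq_dim]
  exact (Multiset.count_le_card _ _).trans A.charpoly.card_roots'

theorem exists_isPrimaryResolution {κ 𝕜 : Type*} [Fintype κ] [DecidableEq κ] [Field 𝕜]
    [IsAlgClosed 𝕜] (A : Matrix κ κ 𝕜) :
    ∃ (S : Finset 𝕜) (e : S → Matrix κ κ 𝕜),
      IsPrimaryResolution A (fun c : S => (c : 𝕜)) e (Fintype.card κ) := by
  classical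
  rcases isEmpty_or_nonempty κ with _ | _
  · exact ⟨∅, 0, Subsingleton.elim _ _, fun c => isEmptyElim c, fun c => isEmptyElim c⟩
  set S := A.charpoly.roots.toFinset
  have hS : ∀ c, c ∈ S ↔ c ∈ spectrum 𝕜 A := fun c => by
    rw [Multiset.mem_toFinset, Polynomial.mem_roots A.charpoly_monic.ne_zero,
      Matrix.mem_spectrum_iff_isRoot_charpoly]
  obtain ⟨c₀, hc₀⟩ := spectrum.nonempty_of_isAlgClosed_of_finiteDimensional 𝕜 A
  have : Nonempty S := ⟨⟨c₀, (hS c₀).2 hc₀⟩⟩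
  let q : S → Polynomial 𝕜 := fun c => (Polynomial.X - Polynomial.C (c : 𝕜)) ^ Fintype.card κ
  have hcoprime : Pairwise (Function.onFun IsCoprime q) := fun _ _ hcd =>
    (Polynomial.pairwise_coprime_X_sub_C Subtype.val_injective hcd).pow
  obtain ⟨p, hp⟩ := exists_sum_eq_one_iff_pairwise_coprime'.2 hcoprime
  have haeval_prod : Polynomial.aeval A (∏ c, q c) = 0 := by
    obtain ⟨r, hr⟩ := charpoly_dvd_prod_roots_pow_card A
    rw [Finset.univ_eq_attach, Finset.prod_attach S fun c =>
      (Polynomial.X - Polynomial.C c) ^ Fintype.card κ, hr, map_mul,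
      Matrix.aeval_self_charpoly, zero_mul]
  refine ⟨S, fun c => Polynomial.aeval A (p c * ∏ d ∈ {c}ᶜ, q d), ?_, fun c => ?_,
    fun c => (hS c).1 c.2⟩
  · rw [← map_sum, hp, map_one]
  · have haeval_q : (A - (c : 𝕜) • 1) ^ Fintype.card κ = Polynomial.aeval A (q c) := by
      simp [q, Algebra.algebraMap_eq_smul_one]
    rw [haeval_q, ← map_mul, mul_left_comm, ← Finset.prod_singleton q c,
      Finset.prod_mul_prod_compl, map_mul, haeval_prod, mul_zero]

end PrimaryResolution

section TaylorFormula

variable {n : ℕ} {ι : Type*} [Fintype ι] {A : Matrix (Fin n) (Fin n) ℂ} {c : ι → ℂ}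
  {e : ι → Matrix (Fin n) (Fin n) ℂ} {m : ℕ} {f : ℂ → ℂ}

theorem IsPrimaryResolution.circleIntegral_mul_resolvent (h : IsPrimaryResolution A c e m) {ε : ℝ}
    (hf : IsAdmissibleRadius f (spectrum ℂ A) ε) {a : ℂ} (ha : a ∈ spectrum ℂ A) (k l : Fin n) :
    (∮ w in C(a, ε), f w * (w • 1 - A)⁻¹ k l) =
      ∑ i, if c i = a then 2 * Real.pi * Complex.I * ∑ j ∈ Finset.range m,
        (j.factorial : ℂ)⁻¹ * iteratedDeriv j f (c i) * ((A - c i • 1) ^ j * e i) k l else 0 := by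
  have hne : ∀ i, ∀ w ∈ Metric.sphere a ε, w ≠ c i := fun i w hw hwc =>
    hf.notMem_of_mem_sphere ha hw (hwc ▸ h.mem_spectrum i)
  have hresolvent : Set.EqOn (fun w => f w * (w • 1 - A)⁻¹ k l)
      (fun w => ∑ i, ∑ j ∈ Finset.range m,
        ((A - c i • 1) ^ j * e i) k l * (f w * ((w - c i) ^ (j + 1))⁻¹)) (Metric.sphere a ε) := by
    intro w hw
    simp only [Matrix.inv_eq_right_inv (h.smul_one_sub_mul_sum fun i => hne i w hw),
      Matrix.sum_apply, Matrix.smul_apply, smul_eq_mul, Finset.mul_sum]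
    exact Finset.sum_congr rfl fun i _ => Finset.sum_congr rfl fun j _ => by ring
  have hint : ∀ i j, CircleIntegrable (fun w =>
      ((A - c i • 1) ^ j * e i) k l * (f w * ((w - c i) ^ (j + 1))⁻¹)) a ε := fun i j =>
    (continuousOn_const.mul ((hf.continuousOn_sphere ha).mul (ContinuousOn.inv₀ (by fun_prop)
      fun w hw => pow_ne_zero _ (sub_ne_zero.2 (hne i w hw))))).circleIntegrable hf.pos.le
  rw [circleIntegral.integral_congr hf.pos.le hresolvent, circleIntegral.integral_fun_sum
    fun i _ => CircleIntegrable.fun_sum _ fun j _ => hint i j]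
  refine Finset.sum_congr rfl fun i _ => ?_
  simp only [circleIntegral.integral_fun_sum fun j _ => hint i j,
    circleIntegral.integral_const_mul, hf.circleIntegral_mul_inv_pow ha (h.mem_spectrum i)]
  split_ifs
  · rw [Finset.mul_sum]
    exact Finset.sum_congr rfl fun j _ => by ring
  · simp only [mul_zero, Finset.sum_const_zero]

theorem IsPrimaryResolution.matrixFunction_eq_sum (h : IsPrimaryResolution A c e m)
    (hf : AnalyticOnNhd ℂ f (spectrum ℂ A)) :
    matrixFunction f A = ∑ i, ∑ j ∈ Finset.range m,
      ((j.factorial : ℂ)⁻¹ * iteratedDeriv j f (c i)) • ((A - c i • 1) ^ j * e i) := by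
  obtain ⟨ε, hε, hfε⟩ := ((matrixFunction_eq_contourCalculus f A hf).and
    (eventually_isAdmissibleRadius (Matrix.finite_spectrum A) hf)).exists
  rw [← hε]
  ext k l
  calc contourCalculus f A ε k l
      = ∑ a ∈ (Matrix.finite_spectrum A).toFinset, ∑ i, if c i = a then ∑ j ∈ Finset.range m,
          (j.factorial : ℂ)⁻¹ * iteratedDeriv j f (c i) * ((A - c i • 1) ^ j * e i) k l
          else 0 := by
        rw [contourCalculus, Matrix.sum_apply]
        refine Finset.sum_congr rfl fun a ha => ?_
        rw [Matrix.of_apply, h.circleIntegral_mul_resolvent hfε (by simpa using ha),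
          Finset.mul_sum]
        simp only [mul_ite, mul_zero, inv_mul_cancel_left₀ Complex.two_pi_I_ne_zero]
    _ = ∑ i, ∑ j ∈ Finset.range m,
          (j.factorial : ℂ)⁻¹ * iteratedDeriv j f (c i) * ((A - c i • 1) ^ j * e i) k l := by
        rw [Finset.sum_comm]
        refine Finset.sum_congr rfl fun i _ => ?_
        rw [Finset.sum_ite_eq, if_pos (by simpa using h.mem_spectrum i)]
    _ = _ := by simp only [Matrix.sum_apply, Matrix.smul_apply, smul_eq_mul]

end TaylorFormula

section Contraction

/-- The image `(1 - t) a 1 + t b` of `b` under the homothety with centre `a` and ratio `t`. -/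
def contraction {𝕜 R : Type*} [Ring 𝕜] [Ring R] [Module 𝕜 R] (a : 𝕜) (b : R) (t : 𝕜) : R :=
  ((1 - t) * a) • 1 + t • b

variable {𝕜 R : Type*} [Field 𝕜] [Ring R] [Algebra 𝕜 R]

theorem contraction_one (a : 𝕜) (b : R) : contraction a b 1 = b := by
  simp [contraction]

theorem contraction_eq_aeval (a : 𝕜) (b : R) (t : 𝕜) : contraction a b t =
    Polynomial.aeval b (Polynomial.C ((1 - t) * a) + Polynomial.C t * Polynomial.X) := by
  simp only [contraction, map_add, map_mul, Polynomial.aeval_C, Polynomial.aeval_X,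
    Algebra.algebraMap_eq_smul_one, smul_mul_assoc, one_mul, smul_smul]

theorem spectrum_contraction [IsAlgClosed 𝕜] [FiniteDimensional 𝕜 R] (a : 𝕜) (b : R) (t : 𝕜) :
    spectrum 𝕜 (contraction a b t) = (fun c => (1 - t) * a + t * c) '' spectrum 𝕜 b := by
  rcases subsingleton_or_nontrivial R with _ | _
  · simp only [spectrum.of_subsingleton, Set.image_empty]
  · rw [contraction_eq_aeval, spectrum.map_polynomial_aeval_of_nonempty _ _
      (spectrum.nonempty_of_isAlgClosed_of_finiteDimensional 𝕜 b)]
    simp only [Polynomial.eval_add, Polynomial.eval_mul, Polynomial.eval_C, Polynomial.eval_X]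

theorem contraction_sub_smul_one (a : 𝕜) (b : R) (t c : 𝕜) :
    contraction a b t - ((1 - t) * a + t * c) • 1 = t • (b - c • 1) := by
  rw [contraction]
  module

theorem IsPrimaryResolution.map_contraction {ι : Type*} [Fintype ι] {b : R} {c : ι → 𝕜} {e : ι → R}
    {m : ℕ} (h : IsPrimaryResolution b c e m) (a t : 𝕜) :
    IsPrimaryResolution (contraction a b t) (fun i => (1 - t) * a + t * c i) e m where
  sum_eq_one := h.sum_eq_one
  pow_mul_eq_zero i := by
    rw [contraction_sub_smul_one, smul_pow, smul_mul_assoc, h.pow_mul_eq_zero, smul_zero]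
  mem_spectrum i := by
    rw [contraction_eq_aeval]
    exact spectrum.subset_polynomial_aeval b _ ⟨c i, h.mem_spectrum i, by simp⟩

theorem IsPrimaryResolution.matrixFunction_contraction_eq_sum {n m : ℕ} {ι : Type*} [Fintype ι]
    {A : Matrix (Fin n) (Fin n) ℂ} {c : ι → ℂ} {e : ι → Matrix (Fin n) (Fin n) ℂ} {f : ℂ → ℂ}
    (h : IsPrimaryResolution A c e m) {a t : ℂ}
    (hf : AnalyticOnNhd ℂ f (spectrum ℂ (contraction a A t))) :
    matrixFunction f (contraction a A t) = ∑ i, ∑ j ∈ Finset.range m,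
      (t ^ j * iteratedDeriv j f ((1 - t) * a + t * c i)) •
        ((j.factorial : ℂ)⁻¹ • ((A - c i • 1) ^ j * e i)) := by
  rw [(h.map_contraction a t).matrixFunction_eq_sum hf]
  refine Finset.sum_congr rfl fun i _ => Finset.sum_congr rfl fun j _ => ?_
  rw [contraction_sub_smul_one, smul_pow, smul_mul_assoc, smul_smul, smul_smul]
  congr 1
  ring

theorem exists_contraction_contraction_eq {R : Type*} [Ring R] [Module ℂ R] {K : Set ℂ}
    (hK : Convex ℝ K) {a μ : ℂ} (ha : a ∈ K) (hμ : μ ∈ K) {s t : ℝ} (hs : s ∈ Set.Icc (0 : ℝ) 1)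
    (ht : t ∈ Set.Icc (0 : ℝ) 1) (b : R) :
    ∃ ν ∈ K, contraction a (contraction μ b (t : ℂ)) (s : ℂ) =
      contraction ν b ((s * t : ℝ) : ℂ) := by
  obtain ⟨ν, hν, hcentre⟩ := hK.exists_mem_add_smul_eq ha hμ (sub_nonneg.2 hs.2)
    (mul_nonneg hs.1 (sub_nonneg.2 ht.2))
  refine ⟨ν, hν, ?_⟩
  have hscalar : (1 - (s : ℂ) * t) * ν = (1 - s) * a + s * ((1 - t) * μ) := by
    simp only [Complex.real_smul] at hcentre
    push_cast at hcentre
    linear_combination hcentre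
  simp only [contraction, Complex.ofReal_mul, hscalar]
  module

end Contraction

section IteratedDeriv

variable {𝕜 : Type*} [NontriviallyNormedField 𝕜]

theorem iteratedDeriv_iteratedDeriv (p q : ℕ) (f : 𝕜 → 𝕜) :
    iteratedDeriv p (iteratedDeriv q f) = iteratedDeriv (q + p) f := by
  simp only [iteratedDeriv_eq_iterate, ← Function.iterate_add_apply, add_comm]

theorem analyticOnNhd_iteratedDeriv [CompleteSpace 𝕜] {f : 𝕜 → 𝕜} {s : Set 𝕜}
    (hf : AnalyticOnNhd 𝕜 f s) (p : ℕ) : AnalyticOnNhd 𝕜 (iteratedDeriv p f) s := by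
  rw [iteratedDeriv_eq_iterate]
  exact hf.iterated_deriv p

theorem iteratedDeriv_add_two_sub_const (a : 𝕜) (p : ℕ) :
    iteratedDeriv (p + 2) (fun w => w - a) = 0 := by
  have hderiv : deriv (fun w => w - a) = fun _ => 1 := by
    ext w
    simp
  rw [iteratedDeriv_succ', hderiv]
  ext w
  simp [iteratedDeriv_const]

theorem iteratedDeriv_succ_sub_mul {g : 𝕜 → 𝕜} {w : 𝕜} (a : 𝕜) {p : ℕ}
    (hg : ContDiffAt 𝕜 (p + 1) g w) :
    iteratedDeriv (p + 1) (fun w => (w - a) * g w) w =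
      (w - a) * iteratedDeriv (p + 1) g w + (p + 1) * iteratedDeriv p g w := by
  rw [iteratedDeriv_fun_mul (by fun_prop) (by exact_mod_cast hg), Finset.sum_range_succ',
    Finset.sum_range_succ', Finset.sum_eq_zero fun i _ => by
      rw [iteratedDeriv_add_two_sub_const, Pi.zero_apply, mul_zero, zero_mul]]
  simp [add_comm]

theorem hasDerivAt_pow_mul_iteratedDeriv [CompleteSpace 𝕜] {g : 𝕜 → 𝕜} {a c s : 𝕜}
    (hg : AnalyticAt 𝕜 g ((1 - s) * a + s * c)) (p : ℕ) :
    HasDerivAt (fun s => s ^ (p + 1) * iteratedDeriv p g ((1 - s) * a + s * c))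
      (s ^ p * iteratedDeriv (p + 1) (fun w => (w - a) * g w) ((1 - s) * a + s * c)) s := by
  have hline : HasDerivAt (fun s => (1 - s) * a + s * c) (c - a) s := by
    convert! (((hasDerivAt_id s).const_sub 1).mul_const a).add
      ((hasDerivAt_id s).mul_const c) using 1
    ring
  have hgp : HasDerivAt (iteratedDeriv p g) (iteratedDeriv (p + 1) g ((1 - s) * a + s * c))
      ((1 - s) * a + s * c) := by
    rw [iteratedDeriv_succ, iteratedDeriv_eq_iterate]
    exact (hg.iterated_deriv p).differentiableAt.hasDerivAt
  convert! (hasDerivAt_pow (p + 1) s).mul (hgp.comp s hline) using 1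
  rw [iteratedDeriv_succ_sub_mul a hg.contDiffAt, Nat.add_sub_cancel, Function.comp_apply]
  push_cast
  ring

end IteratedDeriv

section MeanValue

variable {n : ℕ} {A : Matrix (Fin n) (Fin n) ℂ}

theorem eventually_spectrum_contraction_subset {U : Set ℂ} (hU : IsOpen U) {a s : ℂ}
    (hs : spectrum ℂ (contraction a A s) ⊆ U) :
    ∀ᶠ t in 𝓝 s, spectrum ℂ (contraction a A t) ⊆ U := by
  simp only [spectrum_contraction, Set.image_subset_iff] at hs ⊢
  refine (Matrix.finite_spectrum A).eventually_all.2 fun c hc => ?_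
  exact ContinuousAt.eventually_mem (f := fun t => (1 - t) * a + t * c) (by fun_prop)
    (hU.mem_nhds (hs hc))

theorem continuousOn_matrixFunction_contraction {f : ℂ → ℂ} {U : Set ℂ}
    (hf : AnalyticOnNhd ℂ f U) (A : Matrix (Fin n) (Fin n) ℂ) :
    ContinuousOn (fun q : ℂ × ℂ => matrixFunction f (contraction q.1 A q.2))
      {q | spectrum ℂ (contraction q.1 A q.2) ⊆ U} := by
  obtain ⟨S, e, he⟩ := exists_isPrimaryResolution A
  refine ContinuousOn.congr ?_ fun q hq => he.matrixFunction_contraction_eq_sum (hf.mono hq)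
  refine continuousOn_finsetSum _ fun c _ => continuousOn_finsetSum _ fun j _ =>
    ((continuous_snd.pow j).continuousOn.mul ?_).smul continuousOn_const
  refine (analyticOnNhd_iteratedDeriv hf j).continuousOn.comp (by fun_prop) fun q hq => hq ?_
  exact (he.map_contraction q.1 q.2).mem_spectrum c

variable {F : Type*} [NormedAddCommGroup F] [NormedSpace ℂ F]

theorem IsPrimaryResolution.pow_smul_map_matrixFunction_contraction {ι : Type*} [Fintype ι]
    {c : ι → ℂ} {e : ι → Matrix (Fin n) (Fin n) ℂ} {m : ℕ} (he : IsPrimaryResolution A c e m)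
    (L : Matrix (Fin n) (Fin n) ℂ →ₗ[ℂ] F) {f : ℂ → ℂ} {a t : ℂ}
    (hf : AnalyticOnNhd ℂ f (spectrum ℂ (contraction a A t))) (p q : ℕ) :
    t ^ q • L (matrixFunction (iteratedDeriv p f) (contraction a A t)) =
      ∑ i, ∑ j ∈ Finset.range m,
        (t ^ (q + j) * iteratedDeriv (p + j) f ((1 - t) * a + t * c i)) •
          L ((j.factorial : ℂ)⁻¹ • ((A - c i • 1) ^ j * e i)) := by
  rw [he.matrixFunction_contraction_eq_sum (analyticOnNhd_iteratedDeriv hf p)]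
  simp only [map_sum, Finset.smul_sum, iteratedDeriv_iteratedDeriv]
  refine Finset.sum_congr rfl fun i _ => Finset.sum_congr rfl fun j _ => ?_
  rw [map_smul _ (_ * _), smul_smul, pow_add, mul_assoc]

theorem hasDerivAt_pow_smul_matrixFunction_contraction
    (L : Matrix (Fin n) (Fin n) ℂ →ₗ[ℂ] F) {g : ℂ → ℂ} {a s : ℂ}
    (hg : AnalyticOnNhd ℂ g (spectrum ℂ (contraction a A s))) (p : ℕ) :
    HasDerivAt (fun s => s ^ (p + 1) • L (matrixFunction (iteratedDeriv p g) (contraction a A s)))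
      (s ^ p • L (matrixFunction (iteratedDeriv (p + 1) fun w => (w - a) * g w)
        (contraction a A s))) s := by
  obtain ⟨S, e, he⟩ := exists_isPrimaryResolution A
  have hnear : ∀ᶠ t in 𝓝 s, AnalyticOnNhd ℂ g (spectrum ℂ (contraction a A t)) :=
    eventually_spectrum_contraction_subset (isOpen_analyticAt ℂ g) hg
  have hmul : AnalyticOnNhd ℂ (fun w => (w - a) * g w) (spectrum ℂ (contraction a A s)) :=
    (analyticOnNhd_id.sub analyticOnNhd_const).mul hg
  rw [he.pow_smul_map_matrixFunction_contraction L hmul]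
  refine HasDerivAt.congr_of_eventuallyEq ?_ (hnear.mono fun t ht =>
    he.pow_smul_map_matrixFunction_contraction L ht p (p + 1))
  refine HasDerivAt.fun_sum fun c _ => HasDerivAt.fun_sum fun j _ => ?_
  rw [Nat.add_right_comm p 1 j]
  exact (hasDerivAt_pow_mul_iteratedDeriv
    (hg _ ((he.map_contraction a s).mem_spectrum c)) (p + j)).smul_const _

theorem norm_matrixFunction_iteratedDeriv_le (L : Matrix (Fin n) (Fin n) ℂ →ₗ[ℂ] F) {g : ℂ → ℂ}
    {a : ℂ} (p : ℕ) {C : ℝ}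
    (hg : ∀ s ∈ Set.Icc (0 : ℝ) 1, AnalyticOnNhd ℂ g (spectrum ℂ (contraction a A (s : ℂ))))
    (hC : ∀ s ∈ Set.Icc (0 : ℝ) 1, ‖L (matrixFunction (iteratedDeriv (p + 1) fun w =>
      (w - a) * g w) (contraction a A (s : ℂ)))‖ ≤ C) :
    ‖L (matrixFunction (iteratedDeriv p g) A)‖ ≤ C / (p + 1) := by
  have hderiv := fun s hs =>
    (hasDerivAt_pow_smul_matrixFunction_contraction L (hg s hs) p).scomp s
      Complex.ofRealCLM.hasDerivAt
  have hbound := image_norm_le_of_norm_deriv_right_le_deriv_boundary'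
    (B := fun s => s ^ (p + 1) * (C / (p + 1))) (B' := fun s => s ^ p * C)
    (fun s hs => (hderiv s hs).continuousAt.continuousWithinAt)
    (fun s hs => (hderiv s ⟨hs.1, hs.2.le⟩).hasDerivWithinAt) (by simp) (by fun_prop)
    (fun s _ => by
      refine (((hasDerivAt_pow (p + 1) s).mul_const _).congr_deriv ?_).hasDerivWithinAt
      push_cast
      field_simp)
    (fun s hs => by
      rw [Complex.ofRealCLM_apply, Complex.ofReal_one, one_smul, norm_smul, norm_pow,
        Complex.norm_real, Real.norm_of_nonneg hs.1]
      exact mul_le_mul_of_nonneg_left (hC s ⟨hs.1, hs.2.le⟩) (pow_nonneg hs.1 _))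
    (Set.right_mem_Icc.2 zero_le_one)
  simpa [contraction_one] using hbound

theorem nodePolynomial_succ {N : ℕ} (z : Fin (N + 1) → ℂ) :
    nodePolynomial z = (Polynomial.X - Polynomial.C (z 0)) * nodePolynomial (Fin.tail z) :=
  Fin.prod_univ_succ _

theorem norm_matrixFunction_le_of_nodePolynomial_mul (L : Matrix (Fin n) (Fin n) ℂ →ₗ[ℂ] F)
    {K : Set ℂ} (hK : Convex ℝ K) (hne : K.Nonempty) {φ : ℂ → ℂ}
    (hφ : ∀ t ∈ Set.Icc (0 : ℝ) 1, ∀ μ ∈ K,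
      AnalyticOnNhd ℂ φ (spectrum ℂ (contraction μ A (t : ℂ))))
    {N : ℕ} {z : Fin N → ℂ} (hz : ∀ k, z k ∈ K) {C : ℝ}
    (hC : ∀ t ∈ Set.Icc (0 : ℝ) 1, ∀ μ ∈ K, ‖L (matrixFunction
      (iteratedDeriv N fun w => (nodePolynomial z).eval w * φ w) (contraction μ A (t : ℂ)))‖ ≤ C) :
    ‖L (matrixFunction φ A)‖ ≤ C / N.factorial := by
  induction N generalizing C with
  | zero =>
    obtain ⟨μ, hμ⟩ := hne
    simpa [nodePolynomial, contraction_one] using hC 1 (Set.right_mem_Icc.2 zero_le_one) μ hμ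
  | succ N ih =>
    refine (ih (z := Fin.tail z) (C := C / (N + 1)) (fun k => hz k.succ) fun t ht μ hμ =>
      norm_matrixFunction_iteratedDeriv_le L (a := z 0) N (fun s hs => ?_) fun s hs => ?_).trans_eq
      (by rw [Nat.factorial_succ, Nat.cast_mul, Nat.cast_succ, div_div])
    all_goals
      obtain ⟨ν, hν, heq⟩ := exists_contraction_contraction_eq hK (hz 0) hμ hs ht A
      have hst : s * t ∈ Set.Icc (0 : ℝ) 1 := unitInterval.mul_mem hs ht
      rw [heq]
    · exact (analyticOnNhd_eval _ _).mul (hφ _ hst ν hν)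
    · simpa [nodePolynomial_succ, mul_assoc] using hC _ hst ν hν

end MeanValue

section HermiteRemainder

theorem nodeMultiplicity_succ {N : ℕ} (z : Fin (N + 1) → ℂ) (k : Fin N) :
    nodeMultiplicity z k.succ =
      (if z 0 = z k.succ then 1 else 0) + nodeMultiplicity (Fin.tail z) k := by
  simp only [nodeMultiplicity, Nat.card_eq_fintype_card, Fintype.card_subtype,
    Fin.card_filter_univ_succ, Fin.tail]
  split_ifs <;> ring

theorem nodeMultiplicity_ne_zero {N : ℕ} (z : Fin N → ℂ) (k : Fin N) : nodeMultiplicity z k ≠ 0 :=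
  have : Nonempty {i // z i = z k} := ⟨⟨k, rfl⟩⟩
  Nat.card_pos.ne'

theorem exists_eq_nodePolynomial_mul {U : Set ℂ} (hU : IsOpen U) {N : ℕ} {z : Fin N → ℂ}
    (hz : ∀ k, z k ∈ U) {h : ℂ → ℂ} (hh : AnalyticOnNhd ℂ h U)
    (hord : ∀ k, (nodeMultiplicity z k : ℕ∞) ≤ analyticOrderAt h (z k)) :
    ∃ φ : ℂ → ℂ, AnalyticOnNhd ℂ φ U ∧ ∀ w, h w = (nodePolynomial z).eval w * φ w := by
  induction N generalizing h with
  | zero => exact ⟨h, hh, by simp [nodePolynomial]⟩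
  | succ N ih =>
    set a := z 0
    have ha : h a = 0 := apply_eq_zero_of_analyticOrderAt_ne_zero fun h0 => by
      simpa [h0, a, nodeMultiplicity_ne_zero] using hord 0
    have hdslope : AnalyticOnNhd ℂ (dslope h a) U :=
      ((Complex.differentiableOn_dslope (hU.mem_nhds (hz 0))).2
        hh.differentiableOn).analyticOnNhd hU
    have hfactor : h = (fun w => w - a) * dslope h a := by
      ext w
      simpa using (sub_smul_dslope_of_zero ha w).symm
    have hlinear : ∀ w, AnalyticAt ℂ (fun w : ℂ => w - a) w := fun w => by fun_prop
    obtain ⟨φ, hφ, hφeq⟩ := ih (z := Fin.tail z) (fun k => hz k.succ) hdslope fun k => by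
      have hk := hord k.succ
      rw [nodeMultiplicity_succ, hfactor,
        analyticOrderAt_mul (hlinear _) (hdslope _ (hz k.succ))] at hk
      split_ifs at hk with hak
      · rw [← hak, analyticOrderAt_id_sub_const_self, Nat.cast_add, Nat.cast_one] at hk
        rw [Fin.tail, ← hak]
        exact (ENat.add_le_add_iff_left ENat.one_ne_top).1 hk
      · rwa [(hlinear _).analyticOrderAt_eq_zero.2 (sub_ne_zero.2 (Ne.symm hak)), zero_add,
          zero_add] at hk
    refine ⟨φ, hφ, fun w => ?_⟩
    rw [hfactor, Pi.mul_apply, hφeq, nodePolynomial_succ]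
    simp [a, mul_assoc]

theorem Interpolates.le_analyticOrderAt_sub {N : ℕ} {z : Fin N → ℂ} {r f : ℂ → ℂ}
    (hinterp : Interpolates r f z) {k : Fin N} (hr : AnalyticAt ℂ r (z k))
    (hf : AnalyticAt ℂ f (z k)) :
    (nodeMultiplicity z k : ℕ∞) ≤ analyticOrderAt (fun w => f w - r w) (z k) := by
  have hsub : AnalyticAt ℂ (fun w => f w - r w) (z k) := hf.sub hr
  rw [natCast_le_analyticOrderAt_iff_iteratedDeriv_eq_zero hsub]
  intro j hj
  rw [iteratedDeriv_fun_sub hf.contDiffAt hr.contDiffAt, hinterp k j hj, sub_self]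

theorem Interpolates.exists_sub_eq_nodePolynomial_mul {N : ℕ} {z : Fin N → ℂ} {U : Set ℂ}
    (hU : IsOpen U) (hz : ∀ k, z k ∈ U) {f : ℂ → ℂ} (hf : AnalyticOnNhd ℂ f U)
    {u v : Polynomial ℂ} (hinterp : Interpolates (fun w => u.eval w / v.eval w) f z)
    (hv : ∀ k, v.eval (z k) ≠ 0) :
    ∃ φ : ℂ → ℂ, AnalyticOnNhd ℂ φ U ∧
      ∀ w, v.eval w * f w - u.eval w = (nodePolynomial z).eval w * φ w := by
  refine exists_eq_nodePolynomial_mul hU hz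
    (((analyticOnNhd_eval v U).mul hf).sub (analyticOnNhd_eval u U)) fun k => ?_
  have hvk : AnalyticAt ℂ (fun w => v.eval w) (z k) := analyticOnNhd_eval v U _ (hz k)
  have hr : AnalyticAt ℂ (fun w => u.eval w / v.eval w) (z k) :=
    (analyticOnNhd_eval u U _ (hz k)).div hvk (hv k)
  have hsub : AnalyticAt ℂ (fun w => f w - u.eval w / v.eval w) (z k) := (hf _ (hz k)).sub hr
  have hfactor : (fun w => v.eval w * f w - u.eval w) =ᶠ[𝓝 (z k)]
      (fun w => v.eval w) * fun w => f w - u.eval w / v.eval w := by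
    filter_upwards [hvk.continuousAt.eventually_ne (hv k)] with w hw
    rw [Pi.mul_apply, mul_sub, mul_div_cancel₀ _ hw]
  rw [analyticOrderAt_congr hfactor, analyticOrderAt_mul hvk hsub]
  exact (hinterp.le_analyticOrderAt_sub hr (hf _ (hz k))).trans le_add_self

end HermiteRemainder

section Rational

theorem isUnit_aeval_of_eval_ne_zero {𝕜 R : Type*} [Field 𝕜] [IsAlgClosed 𝕜] [Ring R]
    [Algebra 𝕜 R] [FiniteDimensional 𝕜 R] {b : R} {p : Polynomial 𝕜}
    (hp : ∀ c ∈ spectrum 𝕜 b, p.eval c ≠ 0) : IsUnit (Polynomial.aeval b p) := by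
  rcases subsingleton_or_nontrivial R with _ | _
  · exact isUnit_of_subsingleton _
  · rw [← spectrum.zero_notMem_iff 𝕜, spectrum.map_polynomial_aeval_of_nonempty _ _
      (spectrum.nonempty_of_isAlgClosed_of_finiteDimensional 𝕜 b)]
    exact fun ⟨c, hc, hpc⟩ => hp c hc hpc

variable {n : ℕ} {A : Matrix (Fin n) (Fin n) ℂ} {f φ : ℂ → ℂ} {u v ω : Polynomial ℂ}

theorem matrixFunction_div_eval (hφ : AnalyticOnNhd ℂ φ (spectrum ℂ A))
    (hv : ∀ c ∈ spectrum ℂ A, v.eval c ≠ 0) :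
    matrixFunction (fun w => φ w / v.eval w) A =
      (Polynomial.aeval A v)⁻¹ * matrixFunction φ A := by
  have hdet := (Matrix.isUnit_iff_isUnit_det _).1 (isUnit_aeval_of_eval_ne_zero hv)
  have hcancel : matrixFunction φ A =
      matrixFunction (fun w => v.eval w * (φ w / v.eval w)) A := by
    refine matrixFunction_congr fun c hc => ?_
    filter_upwards [v.continuous.continuousAt.eventually_ne (hv c hc)] with w hw
    rw [mul_div_cancel₀ _ hw]
  rw [hcancel, matrixFunction_eval_mul (hφ.div (analyticOnNhd_eval v _) hv),
    Matrix.nonsing_inv_mul_cancel_left _ _ hdet]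

theorem matrixFunction_sub_div_eval (hφ : AnalyticOnNhd ℂ φ (spectrum ℂ A))
    (hv : ∀ c ∈ spectrum ℂ A, v.eval c ≠ 0)
    (hfφ : ∀ c ∈ spectrum ℂ A, ∀ᶠ w in 𝓝 c, v.eval w * f w - u.eval w = ω.eval w * φ w) :
    matrixFunction f A - matrixFunction (fun w => u.eval w / v.eval w) A =
      Polynomial.aeval A ω * (Polynomial.aeval A v)⁻¹ * matrixFunction φ A := by
  have hr : AnalyticOnNhd ℂ (fun w => u.eval w / v.eval w) (spectrum ℂ A) :=
    (analyticOnNhd_eval u _).div (analyticOnNhd_eval v _) hv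
  have hquot := hφ.div (analyticOnNhd_eval v _) hv
  have hdecomp : matrixFunction f A =
      matrixFunction (fun w => u.eval w / v.eval w + ω.eval w * (φ w / v.eval w)) A := by
    refine matrixFunction_congr fun c hc => ?_
    filter_upwards [hfφ c hc, v.continuous.continuousAt.eventually_ne (hv c hc)] with w hw hvw
    field_simp
    linear_combination hw
  rw [hdecomp, matrixFunction_add hr ((analyticOnNhd_eval ω _).mul hquot), add_sub_cancel_left,
    matrixFunction_eval_mul hquot, matrixFunction_div_eval hφ hv, mul_assoc]

end Rational

section Remainder

theorem iteratedDeriv_eval {𝕜 : Type*} [NontriviallyNormedField 𝕜] (p : Polynomial 𝕜) (k : ℕ) :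
    iteratedDeriv k (fun w => p.eval w) = fun w => (Polynomial.derivative^[k] p).eval w := by
  induction k with
  | zero => simp
  | succ k ih =>
    ext w
    rw [iteratedDeriv_succ, ih, Polynomial.deriv, Function.iterate_succ_apply']

theorem iteratedDeriv_sub_eval_of_natDegree_lt {𝕜 : Type*} [NontriviallyNormedField 𝕜]
    {p : Polynomial 𝕜} {k : ℕ} (hp : p.natDegree < k) {g : 𝕜 → 𝕜} {w : 𝕜}
    (hg : ContDiffAt 𝕜 k g w) :
    iteratedDeriv k (fun w => g w - p.eval w) w = iteratedDeriv k g w := by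
  have hpoly : ContDiffAt 𝕜 k (fun w => p.eval w) w := (p.contDiff_aeval k).contDiffAt
  rw [iteratedDeriv_fun_sub hg hpoly, iteratedDeriv_eval,
    Polynomial.iterate_derivative_eq_zero hp]
  simp only [Polynomial.eval_zero, sub_zero]

variable {n N : ℕ} {A : Matrix (Fin n) (Fin n) ℂ} {z : Fin N → ℂ} {f : ℂ → ℂ} {v : Polynomial ℂ}

theorem remainderMatrix_eq (A : Matrix (Fin n) (Fin n) ℂ) (z : Fin N → ℂ) (f : ℂ → ℂ)
    (v : Polynomial ℂ) (t : ℝ) (μ : ℂ) :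
    remainderMatrix A z f v t μ =
      Polynomial.aeval A (nodePolynomial z) * (Polynomial.aeval A v)⁻¹ * ((N.factorial : ℂ)⁻¹ •
        matrixFunction (iteratedDeriv N fun w => v.eval w * f w) (contraction μ A (t : ℂ))) :=
  rfl

theorem spectrum_contraction_subset_convexJoin {K : Set ℂ} {μ : ℂ} (hμ : μ ∈ K) {t : ℝ}
    (ht : t ∈ Set.Icc (0 : ℝ) 1) (A : Matrix (Fin n) (Fin n) ℂ) :
    spectrum ℂ (contraction μ A (t : ℂ)) ⊆ convexJoin ℝ K (spectrum ℂ A) := by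
  rw [spectrum_contraction]
  rintro _ ⟨c, hc, rfl⟩
  refine mem_convexJoin.2 ⟨μ, hμ, c, hc, 1 - t, t, sub_nonneg.2 ht.2, ht.1, sub_add_cancel _ _, ?_⟩
  simp

theorem continuousOn_remainderMatrix {U K : Set ℂ} (hf : AnalyticOnNhd ℂ f U)
    (hKU : convexJoin ℝ K (spectrum ℂ A) ⊆ U) (z : Fin N → ℂ) (v : Polynomial ℂ) :
    ContinuousOn (fun q : ℝ × ℂ => remainderMatrix A z f v q.1 q.2) (Set.Icc 0 1 ×ˢ K) := by
  have hvf : AnalyticOnNhd ℂ (fun w => v.eval w * f w) U := (analyticOnNhd_eval v U).mul hf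
  have hcalculus : ContinuousOn (fun q : ℝ × ℂ => matrixFunction
      (iteratedDeriv N fun w => v.eval w * f w) (contraction q.2 A (q.1 : ℂ)))
      (Set.Icc 0 1 ×ˢ K) := by
    refine (continuousOn_matrixFunction_contraction (analyticOnNhd_iteratedDeriv hvf N) A).comp
      (f := fun q : ℝ × ℂ => (q.2, (q.1 : ℂ))) (s := Set.Icc 0 1 ×ˢ K) (by fun_prop) fun q hq => ?_
    exact (spectrum_contraction_subset_convexJoin hq.2 hq.1 A).trans hKU
  simp only [remainderMatrix_eq]
  exact continuousOn_const.mul (hcalculus.fun_const_smul _)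

variable {F : Type*} [NormedAddCommGroup F] [NormedSpace ℂ F]

theorem exists_isGreatest_norm_map_remainderMatrix {U K : Set ℂ} (hf : AnalyticOnNhd ℂ f U)
    (hK : IsCompact K) (hne : K.Nonempty) (hKU : convexJoin ℝ K (spectrum ℂ A) ⊆ U)
    (z : Fin N → ℂ) (v : Polynomial ℂ) (ξ : Matrix (Fin n) (Fin n) ℂ →ₗ[ℂ] F) :
    ∃ m, IsGreatest {x : ℝ | ∃ t ∈ Set.Icc (0 : ℝ) 1, ∃ μ ∈ K,
      x = ‖ξ (remainderMatrix A z f v t μ)‖} m := by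
  have hcont : ContinuousOn (fun q : ℝ × ℂ => ‖ξ (remainderMatrix A z f v q.1 q.2)‖)
      (Set.Icc 0 1 ×ˢ K) :=
    (ξ.continuous_of_finiteDimensional.comp_continuousOn
      (continuousOn_remainderMatrix hf hKU z v)).norm
  obtain ⟨⟨t, μ⟩, ⟨ht, hμ⟩, hmax⟩ :=
    (isCompact_Icc.prod hK).exists_isMaxOn ((Set.nonempty_Icc.2 zero_le_one).prod hne) hcont
  refine ⟨_, ⟨t, ht, μ, hμ, rfl⟩, ?_⟩
  rintro _ ⟨s, hs, ν, hν, rfl⟩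
  exact isMaxOn_iff.1 hmax (s, ν) ⟨hs, hν⟩

theorem norm_map_matrixFunction_le_of_remainderMatrix_le {U K : Set ℂ} (hU : IsOpen U)
    (hK : Convex ℝ K) (hne : K.Nonempty) (hz : ∀ k, z k ∈ K)
    (hKU : convexJoin ℝ K (spectrum ℂ A) ⊆ U) (hf : AnalyticOnNhd ℂ f U) {φ : ℂ → ℂ}
    (hφ : AnalyticOnNhd ℂ φ U) {u : Polynomial ℂ} (hu : u.natDegree < N)
    (hfφ : ∀ w, v.eval w * f w - u.eval w = (nodePolynomial z).eval w * φ w)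
    (ξ : Matrix (Fin n) (Fin n) ℂ →ₗ[ℂ] F) {m : ℝ}
    (hm : ∀ t ∈ Set.Icc (0 : ℝ) 1, ∀ μ ∈ K, ‖ξ (remainderMatrix A z f v t μ)‖ ≤ m) :
    ‖ξ (Polynomial.aeval A (nodePolynomial z) * (Polynomial.aeval A v)⁻¹ *
      matrixFunction φ A)‖ ≤ m := by
  have hspec : ∀ t ∈ Set.Icc (0 : ℝ) 1, ∀ μ ∈ K, spectrum ℂ (contraction μ A (t : ℂ)) ⊆ U :=
    fun t ht μ hμ => (spectrum_contraction_subset_convexJoin hμ ht A).trans hKU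
  have hvf := (analyticOnNhd_eval v U).mul hf
  have hderiv : ∀ w ∈ U, iteratedDeriv N (fun w => (nodePolynomial z).eval w * φ w) w =
      iteratedDeriv N (fun w => v.eval w * f w) w := fun w hw => by
    rw [← iteratedDeriv_sub_eval_of_natDegree_lt hu (hvf w hw).contDiffAt]
    simp only [hfφ]
  have hfactorial : (N.factorial : ℝ) ≠ 0 := by exact_mod_cast N.factorial_ne_zero
  let L := ξ ∘ₗ LinearMap.mulLeft ℂ
    (Polynomial.aeval A (nodePolynomial z) * (Polynomial.aeval A v)⁻¹)
  have hbound : ‖L (matrixFunction φ A)‖ ≤ N.factorial * m / N.factorial := by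
    refine norm_matrixFunction_le_of_nodePolynomial_mul L hK hne
      (fun t ht μ hμ => hφ.mono (hspec t ht μ hμ)) hz fun t ht μ hμ => ?_
    have hcongr := matrixFunction_congr fun c hc =>
      (Set.EqOn.eventuallyEq_of_mem hderiv (hU.mem_nhds (hspec t ht μ hμ hc)))
    rw [hcongr, ← inv_mul_le_iff₀ (by positivity)]
    convert! hm t ht μ hμ using 1
    rw [remainderMatrix_eq, mul_smul_comm, map_smul, norm_smul, norm_inv, Complex.norm_natCast]
    rfl
  rwa [mul_div_cancel_left₀ _ hfactorial] at hbound

end Remainder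

theorem theoremt_general {n N : ℕ} {F : Type*} [NormedAddCommGroup F] [NormedSpace ℂ F]
    (A : Matrix (Fin n) (Fin n) ℂ) (z : Fin N → ℂ) (U : Set ℂ) (hU : IsOpen U)
    (hKU : convexJoin ℝ (convexHull ℝ (Set.range z)) (spectrum ℂ A) ⊆ U)
    (f : ℂ → ℂ) (hf : AnalyticOnNhd ℂ f U) (u v : Polynomial ℂ) (hu : u.natDegree < N)
    (hinterp : Interpolates (fun w => u.eval w / v.eval w) f z)
    (hvz : ∀ k, v.eval (z k) ≠ 0) (hvA : ∀ c ∈ spectrum ℂ A, v.eval c ≠ 0)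
    (ξ : Matrix (Fin n) (Fin n) ℂ →ₗ[ℂ] F) :
    ∃ m : ℝ,
      IsGreatest {x : ℝ | ∃ t ∈ Set.Icc (0 : ℝ) 1, ∃ μ ∈ convexHull ℝ (Set.range z),
        x = ‖ξ (remainderMatrix A z f v t μ)‖} m ∧
      ‖ξ (matrixFunction f A - matrixFunction (fun w => u.eval w / v.eval w) A)‖ ≤ m := by
  have hz : ∀ k, z k ∈ convexHull ℝ (Set.range z) := fun k =>
    subset_convexHull ℝ _ (Set.mem_range_self k)
  have hne : (convexHull ℝ (Set.range z)).Nonempty := ⟨_, hz ⟨0, hu.pos⟩⟩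
  obtain ⟨m, hm⟩ := exists_isGreatest_norm_map_remainderMatrix hf
    ((Set.finite_range z).isCompact_convexHull ℝ) hne hKU z v ξ
  have hle : ∀ t ∈ Set.Icc (0 : ℝ) 1, ∀ μ ∈ convexHull ℝ (Set.range z),
      ‖ξ (remainderMatrix A z f v t μ)‖ ≤ m := fun t ht μ hμ => hm.2 ⟨t, ht, μ, hμ, rfl⟩
  refine ⟨m, hm, ?_⟩
  rcases isEmpty_or_nonempty (Fin n) with _ | _
  · rw [Subsingleton.elim (matrixFunction f A - _) (remainderMatrix A z f v 1 (z ⟨0, hu.pos⟩))]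
    exact hle 1 (Set.right_mem_Icc.2 zero_le_one) _ (hz _)
  have hzU := (subset_convexJoin_left
    (spectrum.nonempty_of_isAlgClosed_of_finiteDimensional ℂ A)).trans hKU
  have hAU := (subset_convexJoin_right hne).trans hKU
  obtain ⟨φ, hφ, hfφ⟩ := hinterp.exists_sub_eq_nodePolynomial_mul hU (fun k => hzU (hz k)) hf hvz
  rw [matrixFunction_sub_div_eval (hφ.mono hAU) hvA fun c _ => .of_forall hfφ]
  exact norm_map_matrixFunction_le_of_remainderMatrix_le hU (convex_convexHull ℝ _) hne hz hKU hf
    hφ hu hfφ ξ hle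

theorem theoremt {n N : ℕ} (hN : 0 < N) (A : Matrix (Fin n) (Fin n) ℂ) (z : Fin N → ℂ)
    (U : Set ℂ) (hU : IsOpen U) (hKU : convexHull ℝ (spectrum ℂ A ∪ Set.range z) ⊆ U)
    (f : ℂ → ℂ) (hf : AnalyticOnNhd ℂ f U)
    (u v : Polynomial ℂ) (hL : u.natDegree ≤ N - 1)
    (hinterp : Interpolates (fun w => u.eval w / v.eval w) f z)
    (hvz : ∀ k, v.eval (z k) ≠ 0) (hvA : ∀ c ∈ spectrum ℂ A, v.eval c ≠ 0)
    (ξ : Matrix (Fin n) (Fin n) ℂ →ₗ[ℂ] ℂ) :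
    ∃ m : ℝ,
      IsGreatest {x : ℝ | ∃ t ∈ Set.Icc (0 : ℝ) 1, ∃ μ ∈ convexHull ℝ (Set.range z),
        x = ‖ξ (remainderMatrix A z f v t μ)‖} m ∧
      ‖ξ (matrixFunction f A - matrixFunction (fun w => u.eval w / v.eval w) A)‖ ≤ m := by
  have hjoin : convexJoin ℝ (convexHull ℝ (Set.range z)) (spectrum ℂ A) ⊆ U :=
    (convexJoin_subset (convexHull_mono Set.subset_union_right)
      (Set.subset_union_left.trans (subset_convexHull ℝ _)) (convex_convexHull ℝ _)).trans hKU
  exact theoremt_general A z U hU hjoin f hf u v (by omega) hinterp hvz hvA ξ
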